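/- Let $k$ be a field of characteristic $\neq 2$ and let $M\supset k$ be a Hilbertian field (for example a number field). Here $M$ is called Hilbertian if for all finitely many polynomials $f_1,\dots,f_r\in M[T][X]$ that are irreducible and separable as polynomials in $X$ over $M(T)$, and every nonzero $g\in M[T]$, there is $c\in M$ with $g(c)\neq 0$ such that all $f_i(c,X)$ are irreducible over $M$. Consider the families $$f_t^{C_3}(X)=X^3-tX^2-(t+3)X-1,\qquad f_t^{S_3}(X)=X^3+tX+t,\qquad f_{s,t}^{D_4}(X)=X^4+sX^2+t.$$ Let $f^G$ be one of them and put $n=1$ for $G=C_3,S_3$ and $n=2$ for $G=D_4$. For $\mathbf a\in M^n$ let $\mathrm{Spl}_M f^G_{\mathbf a}$ be the field generated over $M$ by the roots of $f^G_{\mathbf a}(X)$ in a fixed algebraic closure of $M$. Then for every $\mathbf a\in M^n$ such that $f^G_{\mathbf a}(X)$ is separable, there are infinitely many $\mathbf b\in M^n$ such that $f^G_{\mathbf b}(X)$ is separable and $$\mathrm{Spl}_M f^G_{\mathbf a}=\mathrm{Spl}_M f^G_{\mathbf b}.$$ -/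

import Mathlib

open Polynomial

/-- A field `K` is Hilbertian if every separable Hilbert subset of `K` is non-empty: given finitely
many polynomials `f(T, X)` with coefficients in `K[T]`, each irreducible and separable as a
polynomial in `X` over the rational function field `K(T)`, and a nonzero `g(T)`, some `c` in `K`
satisfies `g(c) ≠ 0` and makes every `f(c, X)` irreducible over `K`.
The outer variable of `K[X][X]` is `X`, the inner one is `T`. -/
def IsHilbertian (K : Type*) [Field K] : Prop :=
  ∀ (S : Finset K[X][X]) (g : K[X]), g ≠ 0 →
    (∀ f ∈ S, Irreducible (f.map (algebraMap K[X] (RatFunc K))) ∧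
      (f.map (algebraMap K[X] (RatFunc K))).Separable) →
    ∃ c : K, g.eval c ≠ 0 ∧ ∀ f ∈ S, Irreducible (f.map (evalRingHom c))

/-- `Spl_M f`: the subfield of the fixed algebraic closure of `M` generated over `M` by the roots
of `f`. -/
noncomputable def Spl (M : Type*) [Field M] (f : M[X]) : IntermediateField M (AlgebraicClosure M) :=
  IntermediateField.adjoin M (f.rootSet (AlgebraicClosure M))

/-- The cubic `X³ - tX² - (t+3)X - 1` (for the group `C₃`). -/
noncomputable def fC3 {R : Type*} [CommRing R] (t : R) : R[X] :=
  X ^ 3 - C t * X ^ 2 - C (t + 3) * X - 1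

/-- The cubic `X³ + tX + t` (for the group `S₃`). -/
noncomputable def fS3 {R : Type*} [CommRing R] (t : R) : R[X] :=
  X ^ 3 + C t * X + C t

/-- The quartic `X⁴ + sX² + t` (for the group `D₄`), with parameter the pair `p = (s, t)`. -/
noncomputable def fD4 {R : Type*} [CommRing R] (p : R × R) : R[X] :=
  X ^ 4 + C p.1 * X ^ 2 + C p.2

open IntermediateField

/-! The property of `M` that drives the proof is infinitude. A root `x` of $f_{\mathbf a}$ is
replaced by another generator of $M(x)$, depending on a parameter $z\in M$ and chosen so that it is
again a root of a member of the family: a Möbius image for $C_3$, a rescaled trace-zero polynomial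
in `x` for $S_3$, a multiple of `x` for $D_4$. By `separable_and_Spl_eq` the splitting field is
unchanged. The new parameter (for $D_4$, its second coordinate) is a non-constant rational function
of $z$, hence takes infinitely many values by `infinite_of_forall_eval_div_mem`; for the cubics,
separability of $f_{\mathbf a}$ is what excludes constancy. -/

theorem IsHilbertian.infinite {M : Type*} [Field M] (hM : IsHilbertian M) : Infinite M := by
  by_contra h
  rw [not_infinite_iff_finite] at h
  have := Fintype.ofFinite M
  obtain ⟨c, hc, -⟩ := hM ∅ (∏ c : M, (X - C c))
    (Finset.prod_ne_zero_iff.2 fun c _ => X_sub_C_ne_zero c) (by simp)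
  refine hc ?_
  rw [eval_prod]
  exact Finset.prod_eq_zero (Finset.mem_univ c) (by simp)

/-- A non-constant rational function `N / D` over an infinite field takes infinitely many values,
even off the zeros of a nonzero polynomial `B`. -/
theorem infinite_of_forall_eval_div_mem {M : Type*} [Field M] [Infinite M] {S : Set M}
    (N D B : M[X]) (hD : D ≠ 0) (hB : B ≠ 0) (hND : ∀ b, N - C b * D ≠ 0)
    (h : ∀ z, D.eval z ≠ 0 → B.eval z ≠ 0 → N.eval z / D.eval z ∈ S) : S.Infinite := by
  intro hS
  have hP : D * B * ∏ b ∈ hS.toFinset, (N - C b * D) ≠ 0 :=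
    mul_ne_zero (mul_ne_zero hD hB) (Finset.prod_ne_zero_iff.2 fun b _ => hND b)
  obtain ⟨z, hz⟩ : ∃ z, (D * B * ∏ b ∈ hS.toFinset, (N - C b * D)).eval z ≠ 0 := by
    by_contra! hall
    exact hP (Polynomial.funext fun z => by simpa using hall z)
  simp only [eval_mul, eval_prod, mul_ne_zero_iff, Finset.prod_ne_zero_iff] at hz
  refine hz.2 _ (hS.mem_toFinset.2 (h z hz.1.1 hz.1.2)) ?_
  simp [div_mul_cancel₀ _ hz.1.1]

/-- If the roots of a separable polynomial `f` are mapped injectively to roots of `g`, where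
`deg f = deg g` and each root generates the same field as its image, then `g` is separable with
the same splitting field as `f`. -/
theorem separable_and_Spl_eq {M : Type*} [Field M] {f g : M[X]} (hf : f.Separable)
    (hg : g ≠ 0) (hdeg : g.natDegree = f.natDegree)
    (φ : AlgebraicClosure M → AlgebraicClosure M)
    (hroot : ∀ x, aeval x f = 0 → aeval (φ x) g = 0)
    (hφ : ∀ x, aeval x f = 0 → φ x ∈ M⟮x⟯) (hψ : ∀ x, aeval x f = 0 → x ∈ M⟮φ x⟯)
    (hinj : ∀ x y, aeval x f = 0 → aeval y f = 0 → φ x = φ y → x = y) :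
    g.Separable ∧ Spl M f = Spl M g := by
  classical
  have hf0 : f ≠ 0 := hf.ne_zero
  have hmaps : Set.MapsTo φ (f.rootSet (AlgebraicClosure M)) (g.rootSet (AlgebraicClosure M)) :=
    fun x hx => (mem_rootSet_of_ne hg).2 (hroot x ((mem_rootSet_of_ne hf0).1 hx))
  have hinj' : Set.InjOn φ (f.rootSet (AlgebraicClosure M)) := fun x hx y hy =>
    hinj x y ((mem_rootSet_of_ne hf0).1 hx) ((mem_rootSet_of_ne hf0).1 hy)
  have hcf : (f.rootSet (AlgebraicClosure M)).ncard = f.natDegree := by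
    rw [← Nat.card_coe_set_eq, Nat.card_eq_fintype_card]
    exact card_rootSet_eq_natDegree hf (IsAlgClosed.splits _)
  have hcg : (g.rootSet (AlgebraicClosure M)).ncard ≤ g.natDegree := by
    rw [rootSet_def, Set.ncard_coe_finset]
    refine (Multiset.toFinset_card_le _).trans ((card_roots' _).trans ?_)
    exact natDegree_map_le
  -- Counting: `f` has `deg f` distinct roots and `g` at most as many, so the injection `φ` is onto.
  have himage : φ '' f.rootSet (AlgebraicClosure M) = g.rootSet (AlgebraicClosure M) := by
    refine Set.eq_of_subset_of_ncard_le hmaps.image_subset ?_ (rootSet_finite _ _)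
    rw [hinj'.ncard_image]
    omega
  refine ⟨?_, ?_⟩
  · rw [← card_rootSet_eq_natDegree_iff_of_splits hg
      (IsAlgClosed.splits (g.map (algebraMap M (AlgebraicClosure M)))),
      ← Nat.card_eq_fintype_card, Nat.card_coe_set_eq, ← himage,
      hinj'.ncard_image, hcf, hdeg]
  · unfold Spl
    apply le_antisymm
    · rw [adjoin_le_iff]
      intro x hx
      refine adjoin_le_iff.2 ?_ (hψ x ((mem_rootSet_of_ne hf0).1 hx))
      simpa using subset_adjoin M _ (hmaps hx)
    · rw [adjoin_le_iff, ← himage]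
      rintro _ ⟨x, hx, rfl⟩
      refine adjoin_le_iff.2 ?_ (hφ x ((mem_rootSet_of_ne hf0).1 hx))
      simpa using subset_adjoin M _ hx

/-! ### Degrees and discriminants. -/

section Families

variable {M : Type*} [Field M]

theorem natDegree_fC3 (a : M) : (fC3 a).natDegree = 3 := by
  unfold fC3; compute_degree!

theorem natDegree_fS3 (a : M) : (fS3 a).natDegree = 3 := by
  unfold fS3; compute_degree!

theorem natDegree_fD4 (p : M × M) : (fD4 p).natDegree = 4 := by
  unfold fD4; compute_degree!

theorem ne_zero_of_natDegree_eq_succ {f : M[X]} {n : ℕ} (h : f.natDegree = n + 1) : f ≠ 0 := by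
  rintro rfl; simp at h

/-- A separable polynomial has no common zero with its derivative. -/
theorem Polynomial.Separable.eval_derivative_ne_zero {f : M[X]} (hf : f.Separable) {x : M}
    (hx : f.eval x = 0) : f.derivative.eval x ≠ 0 := by
  obtain ⟨u, v, huv⟩ := hf
  intro h
  simpa [hx, h] using congrArg (eval x) huv

/-- The discriminant is $(a^2+3a+9)^2$; where it vanishes the cubic has a triple root, $a/3$, or $1$
in characteristic 3. -/
theorem discr_ne_zero_of_separable_fC3 {a : M} (h : (fC3 a).Separable) : a ^ 2 + 3 * a + 9 ≠ 0 := by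
  intro h0
  by_cases h3 : (3 : M) = 0
  · have ha : a = 0 := by
      rw [← sq_eq_zero_iff]
      linear_combination h0 - (a + 3) * h3
    refine h.eval_derivative_ne_zero (x := 1) ?_ ?_
    · simp [fC3, ha, h3]
    · simp only [fC3, ha, derivative_sub, derivative_X_pow, derivative_mul, derivative_C,
        derivative_X, derivative_one, eval_sub, eval_mul, eval_pow, eval_X, eval_C, eval_add,
        eval_zero, eval_one, Nat.cast_ofNat]
      ring
  · refine h.eval_derivative_ne_zero (x := a / 3) ?_ ?_
    · simp only [fC3, eval_sub, eval_mul, eval_pow, eval_X, eval_C, eval_one]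
      field_simp
      linear_combination -(2 * a + 3) * h0
    · simp [fC3]
      field_simp
      linear_combination -3 * h0

theorem discr_ne_zero_of_separable_fS3 {a : M} (h : (fS3 a).Separable) :
    a ≠ 0 ∧ 4 * a + 27 ≠ 0 := by
  refine ⟨fun h0 => h.eval_derivative_ne_zero (x := 0) (by simp [fS3, h0]) (by simp [fS3, h0]),
    fun h0 => ?_⟩
  have h2 : (2 : M) ≠ 0 := fun h2 =>
    one_ne_zero (α := M) (by linear_combination h0 - (2 * a + 13) * h2)
  -- The double root when $4a+27=0$.
  refine h.eval_derivative_ne_zero (x := -3 / 2) ?_ ?_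
  · simp only [fS3, eval_add, eval_mul, eval_pow, eval_X, eval_C]
    field_simp
    linear_combination -h0
  · simp [fS3]
    field_simp
    linear_combination h0

theorem ne_zero_of_separable_fD4 {p : M × M} (h : (fD4 p).Separable) : p.2 ≠ 0 := by
  intro h0
  exact h.eval_derivative_ne_zero (x := 0) (by simp [fD4, h0]) (by simp [fD4])

/-! ### Transformations of the roots of the cubics. -/

/-- The map $x\mapsto(zx-1)/(x+z+1)$ commutes with the order-3 map $x\mapsto-1/(x+1)$ permuting the
roots. Its determinant is $z^2+z+1$, and `hD` says that its pole $-z-1$ is not a root. -/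
theorem fC3_separable_and_Spl_eq {a z : M} (ha : (fC3 a).Separable)
    (hD : z ^ 3 + 3 * z ^ 2 - 1 + a * z * (z + 1) ≠ 0) (hz : z ^ 2 + z + 1 ≠ 0) :
    (fC3 ((a * (z ^ 3 - 3 * z - 1) - 9 * z * (z + 1)) /
      (z ^ 3 + 3 * z ^ 2 - 1 + a * z * (z + 1)))).Separable ∧
    Spl M (fC3 a) = Spl M (fC3 ((a * (z ^ 3 - 3 * z - 1) - 9 * z * (z + 1)) /
      (z ^ 3 + 3 * z ^ 2 - 1 + a * z * (z + 1)))) := by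
  set b := (a * (z ^ 3 - 3 * z - 1) - 9 * z * (z + 1)) /
      (z ^ 3 + 3 * z ^ 2 - 1 + a * z * (z + 1)) with hb
  have hbD : b * (z ^ 3 + 3 * z ^ 2 - 1 + a * z * (z + 1)) =
      a * (z ^ 3 - 3 * z - 1) - 9 * z * (z + 1) := div_mul_cancel₀ _ hD
  clear_value b
  let i := algebraMap M (AlgebraicClosure M)
  have hD' : i z ^ 3 + 3 * i z ^ 2 - 1 + i a * i z * (i z + 1) ≠ 0 := by
    have := (map_ne_zero i).2 hD
    simpa [map_ofNat] using this
  have hz' : i z ^ 2 + i z + 1 ≠ 0 := by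
    have := (map_ne_zero i).2 hz
    simpa [map_ofNat] using this
  have hbD' : i b * (i z ^ 3 + 3 * i z ^ 2 - 1 + i a * i z * (i z + 1)) =
      i a * (i z ^ 3 - 3 * i z - 1) - 9 * i z * (i z + 1) := by
    have := congrArg i hbD
    simpa [map_ofNat] using this
  have hroot (c : M) (x : AlgebraicClosure M) :
      aeval x (fC3 c) = x ^ 3 - i c * x ^ 2 - (i c + 3) * x - 1 := by
    simp [fC3, i, map_ofNat]
  have hq (x : AlgebraicClosure M) (hx : aeval x (fC3 a) = 0) : x + i z + 1 ≠ 0 := by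
    intro h0
    rw [hroot, show x = -i z - 1 by linear_combination h0] at hx
    exact hD' (by linear_combination -hx)
  have hinv (x : AlgebraicClosure M) (hx : aeval x (fC3 a) = 0) :
      x = (1 + (i z + 1) * ((i z * x - 1) / (x + i z + 1))) /
        (i z - (i z * x - 1) / (x + i z + 1)) := by
    have hq := hq x hx
    have : i z - (i z * x - 1) / (x + i z + 1) = (i z ^ 2 + i z + 1) / (x + i z + 1) := by
      field_simp; ring
    rw [this, eq_div_iff (div_ne_zero hz' hq)]
    field_simp
    ring
  have hmem (c : M) (y : AlgebraicClosure M) : i c ∈ M⟮y⟯ := IntermediateField.algebraMap_mem _ c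
  refine separable_and_Spl_eq ha (ne_zero_of_natDegree_eq_succ (natDegree_fC3 b))
    ((natDegree_fC3 b).trans (natDegree_fC3 a).symm)
    (fun x => (i z * x - 1) / (x + i z + 1)) ?_ ?_ ?_ ?_
  · intro x hx
    have hq := hq x hx
    rw [hroot] at hx ⊢
    refine (mul_eq_zero.1 ?_).resolve_left hD'
    field_simp
    linear_combination (i z ^ 2 + i z + 1) ^ 3 * hx -
      (i z * x - 1) * (x + i z + 1) * ((i z + 1) * x + i z) * hbD'
  · intro x _
    have hx := mem_adjoin_simple_self M x
    exact div_mem (sub_mem (mul_mem (hmem z x) hx) (one_mem _))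
      (add_mem (add_mem hx (hmem z x)) (one_mem _))
  · intro x hx
    generalize hy : (i z * x - 1) / (x + i z + 1) = y
    have hx := hinv x hx
    rw [hy] at hx
    rw [hx]
    have hy := mem_adjoin_simple_self M y
    exact div_mem (add_mem (one_mem _) (mul_mem (add_mem (hmem z y) (one_mem _)) hy))
      (sub_mem (hmem z y) hy)
  · intro x y hx hy hxy
    rw [hinv x hx, show (i z * x - 1) / (x + i z + 1) = _ from hxy, ← hinv y hy]

/-- Replacing each root `x` of `X³ + aX + a` by a generator `p x` of `M(x)` of trace zero. -/
theorem fS3_separable_and_Spl_eq {a U V : M} (ha : (fS3 a).Separable) (hU : U ≠ 0) (hV : V ≠ 0)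
    (p q : M[X])
    (hp : ∀ x : AlgebraicClosure M, aeval x (fS3 a) = 0 →
      aeval x p ^ 3 + algebraMap M _ U * aeval x p + algebraMap M _ V = 0)
    (hq : ∀ x : AlgebraicClosure M, aeval x (fS3 a) = 0 → aeval (aeval x p) q = x) :
    (fS3 (U ^ 3 / V ^ 2)).Separable ∧ Spl M (fS3 a) = Spl M (fS3 (U ^ 3 / V ^ 2)) := by
  let i := algebraMap M (AlgebraicClosure M)
  have hU' : i U ≠ 0 := (map_ne_zero i).2 hU
  have hV' : i V ≠ 0 := (map_ne_zero i).2 hV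
  have hmem (c : M) (y : AlgebraicClosure M) : i c ∈ M⟮y⟯ := IntermediateField.algebraMap_mem _ c
  have hmem' (f : M[X]) (y : AlgebraicClosure M) (L : IntermediateField M (AlgebraicClosure M))
      (hy : y ∈ L) : aeval y f ∈ L := by
    rw [show y = algebraMap L _ ⟨y, hy⟩ from rfl, aeval_algebraMap_apply]
    exact (aeval (⟨y, hy⟩ : L) f).2
  have hinv (x : AlgebraicClosure M) : i V / i U * (i U / i V * aeval x p) = aeval x p := by
    field_simp
  refine separable_and_Spl_eq ha (ne_zero_of_natDegree_eq_succ (natDegree_fS3 _))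
    ((natDegree_fS3 _).trans (natDegree_fS3 a).symm)
    -- Scaling by $U/V$ turns $Y^3+UY+V$ into a cubic whose last two coefficients both equal
    -- $U^3/V^2$.
    (fun x => i U / i V * aeval x p) ?_ ?_ ?_ ?_
  · intro x hx
    have : aeval (i U / i V * aeval x p) (fS3 (U ^ 3 / V ^ 2)) =
        (i U / i V * aeval x p) ^ 3 + i U ^ 3 / i V ^ 2 * (i U / i V * aeval x p) +
          i U ^ 3 / i V ^ 2 := by
      simp [fS3, i]
    rw [this]
    have := hp x hx
    change aeval x p ^ 3 + i U * aeval x p + i V = 0 at this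
    field_simp
    linear_combination i U ^ 3 * this
  · intro x _
    exact mul_mem (div_mem (hmem U x) (hmem V x)) (hmem' p x _ (mem_adjoin_simple_self M x))
  · intro x hx
    have h := mul_mem (div_mem (hmem V (i U / i V * aeval x p)) (hmem U _))
      (mem_adjoin_simple_self M (i U / i V * aeval x p))
    rw [hinv] at h
    have := hmem' q _ _ h
    rwa [hq x hx] at this
  · intro x y hx hy hxy
    rw [← hq x hx, ← hq y hy, ← hinv x, ← hinv y, show i U / i V * _ = _ from hxy]

/-! ### Infinitely many parameters for the cubics. -/

theorem infinite_fC3 [Infinite M] {a : M} (ha : (fC3 a).Separable) :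
    {b : M | (fC3 b).Separable ∧ Spl M (fC3 a) = Spl M (fC3 b)}.Infinite := by
  have hdisc := discr_ne_zero_of_separable_fC3 ha
  refine infinite_of_forall_eval_div_mem
    (C a * (X ^ 3 - 3 * X - 1) - 9 * X * (X + 1)) (X ^ 3 + 3 * X ^ 2 - 1 + C a * X * (X + 1))
    (X ^ 2 + X + 1) ?_ ?_ ?_ ?_
  · intro h
    simpa using congrArg (fun f => f.eval 0) h
  · intro h
    simpa using congrArg (fun f => f.eval 0) h
  · intro b h
    -- The value at $z=0$ is $a$, so a constant quotient would be $a$; then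
    -- $N-aD=-(a^2+3a+9)(X^2+X)$.
    have h0 : b = a := by
      have h' : C (a - b) * X ^ 3 + C (-(a * b + 3 * b + 9)) * X ^ 2
          + C (-(3 * a + 9 + a * b)) * X + C (b - a) = 0 := by
        rw [← h]; simp only [map_sub, map_add, map_mul, map_neg, map_ofNat]; ring
      simpa [sub_eq_zero] using congrArg (fun f => f.eval 0) h'
    subst h0
    have h' : C (-(b ^ 2 + 3 * b + 9)) * X ^ 2 + C (-(b ^ 2 + 3 * b + 9)) * X = 0 := by
      rw [← h]; simp only [map_add, map_mul, map_neg, map_ofNat, map_pow]; ring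
    have := congrArg (fun f => f.coeff 1) h'
    simp only [coeff_add, coeff_C_mul, coeff_X_pow, coeff_X_one, coeff_zero] at this
    norm_num at this
    exact hdisc (by linear_combination -this)
  · intro z hD hB
    simp only [eval_add, eval_sub, eval_mul, eval_pow, eval_X, eval_C, eval_one, eval_ofNat]
      at hD hB ⊢
    exact fC3_separable_and_Spl_eq ha hD hB

/-- The two leading coefficients of `U³ - bV²`, for `U` of degree 2 and `V` of degree 3. -/
theorem leading_coeffs_eq_zero {u₂ u₁ u₀ v₃ v₂ v₁ v₀ b : M}
    (h : (C u₂ * X ^ 2 + C u₁ * X + C u₀) ^ 3 -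
      C b * (C v₃ * X ^ 3 + C v₂ * X ^ 2 + C v₁ * X + C v₀) ^ 2 = 0) :
    u₂ ^ 3 - b * v₃ ^ 2 = 0 ∧ 3 * u₂ ^ 2 * u₁ - 2 * b * v₃ * v₂ = 0 := by
  have h' : C (u₂ ^ 3 - b * v₃ ^ 2) * X ^ 6 + C (3 * u₂ ^ 2 * u₁ - 2 * b * v₃ * v₂) * X ^ 5 +
      C (3 * u₂ * u₁ ^ 2 + 3 * u₂ ^ 2 * u₀ - b * (2 * v₃ * v₁ + v₂ ^ 2)) * X ^ 4 +
      C (u₁ ^ 3 + 6 * u₂ * u₁ * u₀ - b * (2 * v₃ * v₀ + 2 * v₂ * v₁)) * X ^ 3 +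
      C (3 * u₂ * u₀ ^ 2 + 3 * u₁ ^ 2 * u₀ - b * (2 * v₂ * v₀ + v₁ ^ 2)) * X ^ 2 +
      C (3 * u₁ * u₀ ^ 2 - b * (2 * v₁ * v₀)) * X + C (u₀ ^ 3 - b * v₀ ^ 2) = 0 := by
    rw [← h]
    simp only [map_add, map_sub, map_mul, map_pow, map_ofNat]
    ring
  constructor
  · have := congrArg (fun f => f.coeff 6) h'
    simpa only [coeff_add, coeff_C_mul, coeff_X_pow, coeff_X, coeff_C, coeff_zero, reduceIte,
      Nat.reduceEqDiff, OfNat.ofNat_ne_zero, OfNat.one_ne_ofNat, mul_one,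
      mul_zero, add_zero, zero_add] using this
  · have := congrArg (fun f => f.coeff 5) h'
    simpa only [coeff_add, coeff_C_mul, coeff_X_pow, coeff_X, coeff_C, coeff_zero, reduceIte,
      Nat.reduceEqDiff, OfNat.ofNat_ne_zero, OfNat.one_ne_ofNat, mul_one,
      mul_zero, add_zero, zero_add] using this

theorem infinite_fS3_of_three_ne_zero [Infinite M] (h3 : (3 : M) ≠ 0) {a : M}
    (ha : (fS3 a).Separable) :
    {b : M | (fS3 b).Separable ∧ Spl M (fS3 a) = Spl M (fS3 b)}.Infinite := by
  obtain ⟨ha0, hdisc⟩ := discr_ne_zero_of_separable_fS3 ha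
  set U : M[X] := C (9 * a) * X ^ 2 + C (27 * a) * X + C (-3 * a ^ 2) with hU
  set V : M[X] := C (27 * a) * X ^ 3 + C (-18 * a ^ 2) * X ^ 2 + C (-27 * a ^ 2) * X
    + C (-2 * a ^ 3 - 27 * a ^ 2) with hV
  have h9 : (9 : M) ≠ 0 := by
    rw [show (9 : M) = 3 ^ 2 by norm_num]; exact pow_ne_zero _ h3
  have h27 : (27 : M) ≠ 0 := by
    rw [show (27 : M) = 3 ^ 3 by norm_num]; exact pow_ne_zero _ h3
  have hU0 : U ≠ 0 := fun h => mul_ne_zero h9 ha0 <| by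
    rw [← leadingCoeff_quadratic (mul_ne_zero h9 ha0), ← hU, h, leadingCoeff_zero]
  have hV0 : V ≠ 0 := fun h => mul_ne_zero h27 ha0 <| by
    rw [← leadingCoeff_cubic (mul_ne_zero h27 ha0), ← hV, h, leadingCoeff_zero]
  refine infinite_of_forall_eval_div_mem (U ^ 3) (V ^ 2) (U * (X ^ 3 + C a * X + C a))
    (pow_ne_zero _ hV0) (mul_ne_zero hU0
      (ne_zero_of_natDegree_eq_succ (natDegree_fS3 a))) ?_ ?_
  · intro b h
    -- The top coefficient forces $b=a$; the next then becomes $243a^3(4a+27)$.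
    obtain ⟨h6, h5⟩ := leading_coeffs_eq_zero h
    replace h6 : 729 * a ^ 2 * (a - b) = 0 := by linear_combination h6
    replace h5 : 6561 * a ^ 3 + 972 * a ^ 3 * b = 0 := by linear_combination h5
    have hab : a - b = 0 := by
      refine (mul_eq_zero.1 h6).resolve_left (mul_ne_zero ?_ (pow_ne_zero _ ha0))
      rw [show (729 : M) = 3 ^ 6 by norm_num]; exact pow_ne_zero _ h3
    refine mul_ne_zero (mul_ne_zero (pow_ne_zero 5 h3) (pow_ne_zero 3 ha0)) hdisc ?_
    linear_combination h5 + 972 * a ^ 3 * hab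
  · intro z hD hB
    rw [eval_mul, mul_ne_zero_iff] at hB
    rw [eval_pow] at hD
    rw [eval_pow, eval_pow]
    have hE : z ^ 3 + a * z + a ≠ 0 := by simpa using hB.2
    have hUz : U.eval z = 9 * a * z ^ 2 + 27 * a * z - 3 * a ^ 2 := by
      simp [hU, sub_eq_add_neg]
    have hVz : V.eval z = 27 * a * z ^ 3 - 18 * a ^ 2 * z ^ 2 - 27 * a ^ 2 * z
        - 2 * a ^ 3 - 27 * a ^ 2 := by
      simp [hV]; ring
    let i := algebraMap M (AlgebraicClosure M)
    have hE' : i z ^ 3 + i a * i z + i a ≠ 0 := by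
      have := (map_ne_zero i).2 hE
      simpa [map_ofNat] using this
    have h3' : (3 : AlgebraicClosure M) ≠ 0 := by
      have := (map_ne_zero i).2 h3
      rwa [map_ofNat] at this
    refine fS3_separable_and_Spl_eq ha hB.1 (pow_ne_zero_iff two_ne_zero |>.1 hD)
      -- Trace zero, as $x^2$ has trace $-2a$. The inverse comes from eliminating $x^2$ between
      -- $p(x)$ and $p(x)^2$ reduced modulo the cubic, leaving $9(z^3+az+a)x$.
      (3 * X ^ 2 + C (3 * z) * X + C (2 * a))
      (C (1 / (9 * (z ^ 3 + a * z + a))) * (C (3 * z ^ 2 + a) * (X - C (2 * a)) -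
        (X ^ 2 - C (4 * a ^ 2) + C (18 * z * a)))) ?_ ?_
    · intro x hx
      have hx' : x ^ 3 + i a * x + i a = 0 := by simpa [fS3, i] using hx
      rw [hUz, hVz]
      simp only [map_add, map_sub, map_mul, map_pow, map_ofNat, aeval_X, aeval_C]
      change (3 * x ^ 2 + 3 * i z * x + 2 * i a) ^ 3 + (9 * i a * i z ^ 2 + 27 * i a * i z
        - 3 * i a ^ 2) * (3 * x ^ 2 + 3 * i z * x + 2 * i a) + (27 * i a * i z ^ 3
        - 18 * i a ^ 2 * i z ^ 2 - 27 * i a ^ 2 * i z - 2 * i a ^ 3 - 27 * i a ^ 2) = 0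
      generalize i z = w at *
      generalize i a = c at *
      linear_combination (27 * x ^ 3 + 81 * w * x ^ 2 + (27 * c + 81 * w ^ 2) * x +
        (27 * w ^ 3 + 27 * c * w - 27 * c)) * hx'
    · intro x hx
      have hx' : x ^ 3 + i a * x + i a = 0 := by simpa [fS3, i] using hx
      simp only [map_add, map_sub, map_mul, map_pow, map_ofNat, aeval_X, aeval_C, map_div₀,
        map_one]
      change 1 / (9 * (i z ^ 3 + i a * i z + i a)) * ((3 * i z ^ 2 + i a) *
        (3 * x ^ 2 + 3 * i z * x + 2 * i a - 2 * i a) -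
        ((3 * x ^ 2 + 3 * i z * x + 2 * i a) ^ 2 - 4 * i a ^ 2 + 18 * i z * i a)) = x
      have h9' : (9 : AlgebraicClosure M) ≠ 0 := by
        rw [show (9 : AlgebraicClosure M) = 3 ^ 2 by norm_num]; exact pow_ne_zero _ h3'
      generalize i z = w at *
      generalize i a = c at *
      rw [one_div, inv_mul_eq_iff_eq_mul₀ (mul_ne_zero h9' hE')]
      linear_combination (-9 * x - 18 * w) * hx'

/-- The quadratic substitution degenerates to a constant when $3=0$, but then every translate $x+z$
has trace zero. -/
theorem infinite_fS3_of_three_eq_zero [Infinite M] (h3 : (3 : M) = 0) {a : M}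
    (ha : (fS3 a).Separable) :
    {b : M | (fS3 b).Separable ∧ Spl M (fS3 a) = Spl M (fS3 b)}.Infinite := by
  have ha0 := (discr_ne_zero_of_separable_fS3 ha).1
  set V : M[X] := C a - X ^ 3 - C a * X with hV
  have hVdeg : V.natDegree = 3 := by rw [hV]; compute_degree!
  have hV0 : V ≠ 0 := ne_zero_of_natDegree_eq_succ hVdeg
  refine infinite_of_forall_eval_div_mem (C a ^ 3) (V ^ 2) 1 (pow_ne_zero _ hV0) one_ne_zero ?_ ?_
  · intro b h
    rw [sub_eq_zero, ← C_pow] at h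
    have hb : b ≠ 0 := by
      rintro rfl
      rw [C_0, zero_mul, C_eq_zero] at h
      exact pow_ne_zero _ ha0 h
    have := congrArg natDegree h
    rw [natDegree_C, natDegree_C_mul hb, natDegree_pow, hVdeg] at this
    omega
  · intro z hD _
    rw [eval_pow] at hD
    rw [eval_pow, eval_pow, eval_C]
    have h3' : (3 : AlgebraicClosure M) = 0 := by
      have := congrArg (algebraMap M (AlgebraicClosure M)) h3
      rwa [map_ofNat, map_zero] at this
    refine fS3_separable_and_Spl_eq ha ha0 (pow_ne_zero_iff two_ne_zero |>.1 hD)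
      (X + C z) (X - C z) ?_ ?_
    · intro x hx
      have hx' : x ^ 3 + algebraMap M _ a * x + algebraMap M _ a = 0 := by
        simpa [fS3] using hx
      simp only [hV, eval_sub, eval_C, eval_pow, eval_X, eval_mul, map_add, map_sub, map_mul,
        map_pow, aeval_X, aeval_C]
      generalize algebraMap M (AlgebraicClosure M) z = w at *
      linear_combination hx' + (x ^ 2 * w + x * w ^ 2) * h3'
    · intro x _
      simp

theorem infinite_fS3 [Infinite M] {a : M} (ha : (fS3 a).Separable) :
    {b : M | (fS3 b).Separable ∧ Spl M (fS3 a) = Spl M (fS3 b)}.Infinite := by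
  by_cases h3 : (3 : M) = 0
  · exact infinite_fS3_of_three_eq_zero h3 ha
  · exact infinite_fS3_of_three_ne_zero h3 ha

/-! ### The biquadratic family. -/

/-- Multiplying the roots of `X⁴ + sX² + t` by `c` does not change the splitting field. -/
theorem fD4_separable_and_Spl_eq {p : M × M} (hp : (fD4 p).Separable) {c : M} (hc : c ≠ 0) :
    (fD4 (c ^ 2 * p.1, c ^ 4 * p.2)).Separable ∧
      Spl M (fD4 p) = Spl M (fD4 (c ^ 2 * p.1, c ^ 4 * p.2)) := by
  let i := algebraMap M (AlgebraicClosure M)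
  have hc' : i c ≠ 0 := (map_ne_zero i).2 hc
  have hmem (y : AlgebraicClosure M) : i c ∈ M⟮y⟯ := IntermediateField.algebraMap_mem _ c
  refine separable_and_Spl_eq hp (ne_zero_of_natDegree_eq_succ (natDegree_fD4 _))
    ((natDegree_fD4 _).trans (natDegree_fD4 p).symm) (fun x => i c * x) ?_ ?_ ?_ ?_
  · intro x hx
    have hx' : x ^ 4 + i p.1 * x ^ 2 + i p.2 = 0 := by simpa [fD4, i] using hx
    have : aeval (i c * x) (fD4 (c ^ 2 * p.1, c ^ 4 * p.2)) =
        (i c * x) ^ 4 + i c ^ 2 * i p.1 * (i c * x) ^ 2 + i c ^ 4 * i p.2 := by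
      simp [fD4, i]
    rw [this]
    linear_combination i c ^ 4 * hx'
  · intro x _
    exact mul_mem (hmem x) (mem_adjoin_simple_self M x)
  · intro x _
    have := div_mem (mem_adjoin_simple_self M (i c * x)) (hmem (i c * x))
    rwa [mul_div_cancel_left₀ _ hc'] at this
  · intro x y _ _ hxy
    exact mul_left_cancel₀ hc' hxy

theorem infinite_fD4 [Infinite M] {a : M × M} (ha : (fD4 a).Separable) :
    {b : M × M | (fD4 b).Separable ∧ Spl M (fD4 a) = Spl M (fD4 b)}.Infinite := by
  have ha2 := ne_zero_of_separable_fD4 ha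
  -- It suffices that the second coordinate $z^4t$ takes infinitely many values.
  refine Set.Infinite.of_image Prod.snd ?_
  refine infinite_of_forall_eval_div_mem (C a.2 * X ^ 4) 1 X one_ne_zero X_ne_zero ?_ ?_
  · intro b h
    refine ha2 ?_
    simpa [coeff_C] using congrArg (fun f => f.coeff 4) h
  · intro z _ hz
    rw [eval_X] at hz
    exact ⟨_, fD4_separable_and_Spl_eq ha hz, by simp only [eval_mul, eval_C, eval_pow, eval_X,
      eval_one, div_one, mul_comm]⟩

end Families

theorem corollary1p4 {k M : Type*} [Field k] [Field M] [Algebra k M]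
    (hk : ringChar k ≠ 2) (hM : IsHilbertian M ∨ NumberField M) :
    (∀ a : M, (fC3 a).Separable →
      {b : M | (fC3 b).Separable ∧ Spl M (fC3 a) = Spl M (fC3 b)}.Infinite) ∧
    (∀ a : M, (fS3 a).Separable →
      {b : M | (fS3 b).Separable ∧ Spl M (fS3 a) = Spl M (fS3 b)}.Infinite) ∧
    (∀ a : M × M, (fD4 a).Separable →
      {b : M × M | (fD4 b).Separable ∧ Spl M (fD4 a) = Spl M (fD4 b)}.Infinite) := by
  have : Infinite M := by
    rcases hM with h | h
    · exact h.infinite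
    · have := h.to_charZero
      exact Infinite.of_injective ((↑) : ℕ → M) Nat.cast_injective
  exact ⟨fun a => infinite_fC3, fun a => infinite_fS3, fun a => infinite_fD4⟩
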